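/- Let $p$ be a prime, $\mathbf{F}=\mathrm{GF}(p)$, $n\ge 3$, let $V$ be an $\mathbf{F}$-vector space with basis $v_0,v_1,\dots,v_n$, and let $W=\Lambda^2V$. Let $\alpha$ be a primitive element of $\mathrm{GF}(p^n)$ (a generator of its multiplicative group), $m$ its minimal polynomial over $\mathbf{F}$, and $A=(A_{ij})_{1\le i,j\le n}$ the companion matrix of $m$ (in either of the two usual conventions, which are transposes of each other). Let $b=(b_j)_{1\le j\le n}$ and $c=(c_{jk})_{1\le j<k\le n}$ be nonzero vectors over $\mathbf{F}$, and let $f:V\to W$ be the linear map with $$f(v_0)=\sum_{j=1}^n b_j\, v_0\wedge v_j+\sum_{1\le j<k\le n}c_{jk}\,v_j\wedge v_k,\qquad f(v_i)=\sum_{j=1}^n A_{ij}\,v_0\wedge v_j\quad(1\le i\le n).$$ Write $f(v_i)=\sum_{0\le j<k\le n}a_{i,j,k}\,v_j\wedge v_k$ for $0\le i\le n$, put $q=p$ if $p$ is odd and $q=4$ if $p=2$, and let $P$ be the group with generators $x_0,\dots,x_n$ and defining relations $$[[x_i,x_j],x_k]=1,\qquad x_i^{q}=\prod_{j<k}[x_j,x_k]^{a_{i,j,k}},\qquad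 [x_i,x_j]^p=1\qquad\text{for all } i,j,k .$$ Then $P$ is a finite $p$-group of nilpotence class $2$, and every automorphism of $P$ is central, i.e. takes every $a\in P$ to an element of $aZ(P)$; that is, $\mathrm{Aut}(P)=\mathrm{Aut}_c(P)$. If $p$ is odd, then moreover $P\setminus Z(P)$ is nonempty and no element $a\in P\setminus Z(P)$ is sent to $a^{-1}$ by an automorphism of $P$. -/

import Mathlib

open scoped commutatorElement

noncomputable section

namespace CentralAuto

/-- The group of central automorphisms of `P`: those automorphisms that take every `a` to an
element of the coset `a Z(P)`. -/
def centralAut (P : Type*) [Group P] : Subgroup (MulAut P) where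
  carrier := {φ | ∀ a : P, a⁻¹ * φ a ∈ Subgroup.center P}
  one_mem' := by
    intro a
    simp
  mul_mem' := by
    intro φ ψ hφ hψ a
    have h := Subgroup.mul_mem _ (hψ a) (hφ (ψ a))
    simpa [mul_assoc] using h
  inv_mem' := by
    intro φ hφ a
    have h := Subgroup.inv_mem _ (hφ (φ⁻¹ a))
    simpa using h

section Linear

variable {F V : Type*} [Field F] [AddCommGroup V] [Module F V]

/-- The wedge `x ∧ y` in the exterior square of `V`. -/
def wedge (x y : V) : ⋀[F]^2 V := exteriorPower.ιMulti F 2 ![x, y]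

/-- The coordinate of `w` at the basis vector `v j ∧ v k` (`j < k`) of the exterior square. -/
def wedgeCoord {N : ℕ} (v : Module.Basis (Fin N) F V) (w : ⋀[F]^2 V) (j k : Fin N)
    (h : j < k) : F :=
  (v.exteriorPower 2).repr w
    ⟨{j, k}, by
      rw [Set.powersetCard.mem_iff]
      exact Finset.card_pair h.ne⟩

/-- `f` has, with respect to the basis `v 0, …, v n` of `V` and the basis of the exterior square
that begins with `v 0 ∧ v 1, …, v 0 ∧ v n` and continues with the `v i ∧ v j`, `1 ≤ i < j`, the
block matrix with rows `(b, c)` and `(A, 0)`. Maps act on the right in this convention: the rows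
are the coordinates of the images of the `v i`. -/
def HasBlockMatrix {n : ℕ} (v : Module.Basis (Fin (n + 1)) F V) (f : V →ₗ[F] ⋀[F]^2 V)
    (b : Fin n → F) (c : {q : Fin n × Fin n // q.1 < q.2} → F)
    (A : Matrix (Fin n) (Fin n) F) : Prop :=
  f (v 0) = ∑ j, b j • wedge (v 0) (v j.succ)
      + ∑ q, c q • wedge (v q.1.1.succ) (v q.1.2.succ) ∧
  ∀ i : Fin n, f (v i.succ) = ∑ j, A i j • wedge (v 0) (v j.succ)

/-- The companion matrix of a monic polynomial of degree `n`, for row vectors: ones on the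
superdiagonal, and the last row consists of the negatives of the coefficients. -/
def companion (n : ℕ) (m : Polynomial F) : Matrix (Fin n) (Fin n) F :=
  Matrix.of fun i j =>
    if i.val + 1 = n then -m.coeff j.val else if j.val = i.val + 1 then 1 else 0

end Linear

section Presentation

variable {p N : ℕ} [Fact p.Prime] {V : Type*} [AddCommGroup V] [Module (ZMod p) V]

/-- The exponent `p` of the power relations, replaced by `4` for `p = 2`. -/
def powExp (p : ℕ) : ℕ := if p = 2 then 4 else p

/-- The word `∏_{j < k} [x j, x k] ^ (a j k)`, in lexicographic order, where the `a j k` are the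
coordinates of `w`. -/
def commWord (v : Module.Basis (Fin N) (ZMod p) V) (w : ⋀[ZMod p]^2 V) : FreeGroup (Fin N) :=
  (List.ofFn fun j : Fin N => (List.ofFn fun k : Fin N =>
    if h : j < k then
      ⁅FreeGroup.of j, FreeGroup.of k⁆ ^ (wedgeCoord v w j k h).val
    else 1).prod).prod

/-- The defining relators: `[[x i, x j], x k]`, `x i ^ q = ∏_{j < k} [x j, x k] ^ a i j k` where
`q` is `p` (or `4` if `p = 2`), and `[x i, x j] ^ p`. -/
def relators (v : Module.Basis (Fin N) (ZMod p) V) (f : V →ₗ[ZMod p] ⋀[ZMod p]^2 V) :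
    Set (FreeGroup (Fin N)) :=
  {r | ∃ i j k : Fin N, r = ⁅⁅FreeGroup.of i, FreeGroup.of j⁆, FreeGroup.of k⁆} ∪
  {r | ∃ i : Fin N, r = FreeGroup.of i ^ powExp p * (commWord v (f (v i)))⁻¹} ∪
  {r | ∃ i j : Fin N, r = ⁅FreeGroup.of i, FreeGroup.of j⁆ ^ p}

/-- The group `P` presented by generators and relations from the linear map `f`. -/
abbrev PGroup (v : Module.Basis (Fin N) (ZMod p) V) (f : V →ₗ[ZMod p] ⋀[ZMod p]^2 V) : Type :=
  PresentedGroup (relators v f)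

end Presentation

end CentralAuto

end

/-!
Write `W = ⋀² V`, `v₀ = v 0` and let `U` be the span of `v 1, …, v n`.

*The group.* Dividing a central extension of `ℤ^(n+1)` by `W` (with a cocycle whose
antisymmetrization is the wedge product) by the central subgroup of the pairs `(q u, -f u)` gives a
group in which commutators are wedges and `q`-th powers are values of `f`, and into which `W`
embeds (`exists_model`). The group `P` maps to it. This shows that nothing collapses in `P`: the
map `P → V` sending `x i` to `v i` has kernel exactly `Z(P)`, and an endomorphism of `P` inducing
the linear map `g` on `V` satisfies `f ∘ g = ⋀² g ∘ f`
(`PGroup.exists_hom_with_ker_eq_center`). So it suffices that an injective `g` with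
`f ∘ g = ⋀² g ∘ f` is the identity (`eq_id_of_intertwines`).

*Linear algebra* (`block_rigidity`). Since `f` maps `U` injectively into `v₀ ∧ V` and `gU` into
`g v₀ ∧ V`, and two such subspaces for independent vectors meet in a line while `U ∩ gU` has
dimension at least `n - 1 ≥ 2`, the vector `g v₀` is a multiple `l v₀`. As `c ≠ 0`, only vectors of
`U` are mapped by `f` into `v₀ ∧ V`, so `g` preserves `U`. Comparing components, the restriction
`G` of `g` to `U` satisfies `B G = l G B`, where `B` is the endomorphism of `U` given by the matrix
`A`, and `G b = b`.

*Field theory* (`semilinear_rigidity`). As `B` is annihilated by the minimal polynomial of `α`, the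
space `U` is one-dimensional over `GF(p ^ n)`, with `α` acting as `B`. The relation shows that
`l α` is conjugate to `α`, that is `α ^ p ^ k = l α` with `k < n`; then
`α ^ ((p ^ k - 1) (p - 1)) = 1`, which the order `p ^ n - 1` of `α` permits only for `k = 0`, so
`l = 1`. Now `G` is linear over the field and fixes `b ≠ 0`, hence is the identity.

For odd `p`, an automorphism that inverts `a` also fixes the image of `a` in `V`, so that this image
is zero and `a` is central.
-/

namespace CentralAuto

/-! ### The field `GF(p ^ n)` generated by a primitive element -/

theorem pow_sub_one_mul_lt {p n k : ℕ} (hp : 2 ≤ p) (hk : k < n) :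
    (p ^ k - 1) * (p - 1) < p ^ n - 1 := by
  have h1 : p ^ k * p ≤ p ^ n := by
    rw [← pow_succ]; exact Nat.pow_le_pow_right (by omega) hk
  have h2 : 1 ≤ p ^ k := Nat.one_le_pow _ _ (by omega)
  obtain ⟨a, ha⟩ := Nat.exists_eq_add_of_le h2
  obtain ⟨r, rfl⟩ := Nat.exists_eq_add_of_le hp
  rw [ha] at h1 ⊢
  have : (1 + a - 1) * (2 + r - 1) = a * (1 + r) := by
    congr 1 <;> omega
  rw [this]
  have : (1 + a) * (2 + r) = a * (1 + r) + a + r + 2 := by ring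
  omega

section Field

variable {p : ℕ} [Fact p.Prime] {n : ℕ}

theorem adjoin_eq_top_of_generator {α : (GaloisField p n)ˣ}
    (hα : ∀ x : (GaloisField p n)ˣ, x ∈ Subgroup.zpowers α) :
    Algebra.adjoin (ZMod p) {(α : GaloisField p n)} = ⊤ := by
  rw [eq_top_iff]
  intro x _
  rcases eq_or_ne x 0 with rfl | hx
  · exact zero_mem _
  · obtain ⟨k, hk⟩ := mem_powers_iff_mem_zpowers.2 (hα (Units.mk0 x hx))
    have : x = (α : GaloisField p n) ^ k := by
      simpa using (congrArg Units.val hk).symm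
    rw [this]
    exact pow_mem (Algebra.self_mem_adjoin_singleton _ _) k

theorem orderOf_generator (hn : n ≠ 0) {α : (GaloisField p n)ˣ}
    (hα : ∀ x : (GaloisField p n)ˣ, x ∈ Subgroup.zpowers α) :
    orderOf α = p ^ n - 1 := by
  rw [orderOf_eq_card_of_forall_mem_zpowers hα, Nat.card_units, GaloisField.card p n hn]

/-- The power basis `1, α, α², …` of `GF(p ^ n)`. -/
noncomputable def generatorPowerBasis (α : (GaloisField p n)ˣ)
    (hα : ∀ x : (GaloisField p n)ˣ, x ∈ Subgroup.zpowers α) :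
    PowerBasis (ZMod p) (GaloisField p n) :=
  PowerBasis.ofAdjoinEqTop (Algebra.IsIntegral.isIntegral (α : GaloisField p n))
    (adjoin_eq_top_of_generator hα)

theorem generatorPowerBasis_gen (α : (GaloisField p n)ˣ)
    (hα : ∀ x : (GaloisField p n)ˣ, x ∈ Subgroup.zpowers α) :
    (generatorPowerBasis α hα).gen = α := by
  simp [generatorPowerBasis]

theorem natDegree_minpoly_generator (hn : n ≠ 0) {α : (GaloisField p n)ˣ}
    (hα : ∀ x : (GaloisField p n)ˣ, x ∈ Subgroup.zpowers α) :
    (minpoly (ZMod p) (α : GaloisField p n)).natDegree = n := by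
  rw [← generatorPowerBasis_gen α hα, PowerBasis.natDegree_minpoly,
    ← PowerBasis.finrank, GaloisField.finrank p hn]

/-- Homomorphisms out of `GF(p ^ n)` may take `α` to any root of its minimal polynomial. -/
theorem exists_algHom_generator {α : (GaloisField p n)ˣ}
    (hα : ∀ x : (GaloisField p n)ˣ, x ∈ Subgroup.zpowers α)
    {E : Type*} [Ring E] [Algebra (ZMod p) E] {y : E}
    (hy : Polynomial.aeval y (minpoly (ZMod p) (α : GaloisField p n)) = 0) :
    ∃ θ : GaloisField p n →ₐ[ZMod p] E, θ α = y := by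
  rw [← generatorPowerBasis_gen α hα] at hy
  refine ⟨(generatorPowerBasis α hα).lift y hy, ?_⟩
  conv_lhs => rw [← generatorPowerBasis_gen α hα]
  exact (generatorPowerBasis α hα).lift_gen y hy

/-- No conjugate of a primitive element is a scalar multiple of it, other than itself: the
conjugates are the `α ^ p ^ k` with `k < n`, and `α ^ (p ^ k - 1) = l` has order dividing `p - 1`. -/
theorem eq_one_of_aeval_minpoly_smul_generator (hn : n ≠ 0) {α : (GaloisField p n)ˣ}
    (hα : ∀ x : (GaloisField p n)ˣ, x ∈ Subgroup.zpowers α) {l : ZMod p} (hl : l ≠ 0)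
    (h : Polynomial.aeval (l • (α : GaloisField p n))
      (minpoly (ZMod p) (α : GaloisField p n)) = 0) : l = 1 := by
  obtain ⟨σ, hσ⟩ := exists_algHom_generator hα h
  obtain ⟨k, hk⟩ := (FiniteField.bijective_frobeniusAlgHom_pow (ZMod p) (GaloisField p n)).2 σ
  have hkn : (k : ℕ) < n := k.2.trans_eq (GaloisField.finrank p hn)
  have hpow : (α : GaloisField p n) ^ p ^ (k : ℕ) = l • (α : GaloisField p n) := by
    rw [← hσ, ← hk]
    simp only [FiniteField.coe_frobeniusAlgHom, AlgHom.coe_pow, pow_iterate, ZMod.card]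
  have hp2 := (Fact.out : p.Prime).two_le
  have hα0 : (α : GaloisField p n) ≠ 0 := α.ne_zero
  have hpow' : (α : GaloisField p n) ^ (p ^ (k : ℕ) - 1) = algebraMap (ZMod p) _ l := by
    apply mul_right_cancel₀ hα0
    rw [← pow_succ, Nat.sub_add_cancel (Nat.one_le_pow _ _ (by omega)), hpow, Algebra.smul_def]
  have hone : α ^ ((p ^ (k : ℕ) - 1) * (p - 1)) = 1 := by
    ext
    rw [Units.val_pow_eq_pow_val, pow_mul, hpow', ← map_pow, ZMod.pow_card_sub_one_eq_one hl]
    simp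
  have hdvd := orderOf_dvd_of_pow_eq_one hone
  rw [orderOf_generator hn hα] at hdvd
  have hz := Nat.eq_zero_of_dvd_of_lt hdvd (pow_sub_one_mul_lt hp2 hkn)
  have hz' : p ^ (k : ℕ) - 1 = 0 := by
    rcases Nat.mul_eq_zero.1 hz with h | h
    · exact h
    · omega
  rw [hz', pow_zero] at hpow'
  exact (algebraMap (ZMod p) (GaloisField p n)).injective (by rw [← hpow', map_one])

/-- If a primitive element `α` acts on an `n`-dimensional space as `B`, then an injective
endomorphism `G` that commutes with `B` up to a scalar and fixes a nonzero vector is the identity. -/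
theorem semilinear_rigidity (hn : n ≠ 0) {α : (GaloisField p n)ˣ}
    (hα : ∀ x : (GaloisField p n)ˣ, x ∈ Subgroup.zpowers α)
    {U : Type*} [AddCommGroup U] [Module (ZMod p) U] [FiniteDimensional (ZMod p) U]
    (hU : Module.finrank (ZMod p) U = n) {B G : Module.End (ZMod p) U}
    (hB : Polynomial.aeval B (minpoly (ZMod p) (α : GaloisField p n)) = 0)
    (hG : Function.Injective G) {l : ZMod p} (hl : l ≠ 0) (hBG : B * G = l • (G * B))
    {u : U} (hu : u ≠ 0) (hGu : G u = u) : l = 1 ∧ G = 1 := by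
  obtain ⟨θ, hθ⟩ := exists_algHom_generator hα hB
  have : Nontrivial U := ⟨u, 0, hu⟩
  have hθinj : Function.Injective θ := θ.toRingHom.injective
  have hl1 : l = 1 := by
    refine eq_one_of_aeval_minpoly_smul_generator hn hα hl (hθinj ?_)
    rw [map_zero, ← Polynomial.aeval_algHom_apply, map_smul, hθ]
    -- conjugation by `G` turns `B` into `l • B`, which is therefore also a root of the polynomial
    have key : ∀ q : Polynomial (ZMod p),
        Polynomial.aeval B q * G = G * Polynomial.aeval (l • B) q := by
      intro q
      induction q using Polynomial.induction_on' with
      | add q r hq hr => rw [map_add, map_add, add_mul, mul_add, hq, hr]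
      | monomial k a =>
        have hk : ∀ k : ℕ, B ^ k * G = G * (l • B) ^ k := by
          intro k
          induction k with
          | zero => simp
          | succ k ih =>
            rw [pow_succ, mul_assoc, hBG, ← mul_smul_comm, ← mul_assoc, ih, mul_assoc, pow_succ]
        rw [Polynomial.aeval_monomial, Polynomial.aeval_monomial, mul_assoc, hk, ← mul_assoc,
          Algebra.commutes, mul_assoc]
    ext w
    have := LinearMap.congr_fun (key (minpoly (ZMod p) (α : GaloisField p n))) w
    rw [hB] at this
    apply hG
    simpa using this.symm
  refine ⟨hl1, ?_⟩
  subst hl1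
  -- `U` is a line over `GF(p ^ n)`, spanned by the fixed vector `u`
  let L : GaloisField p n →ₗ[ZMod p] U := (LinearMap.applyₗ u).comp θ.toLinearMap
  have hL : ∀ x, L x = θ x u := fun _ => rfl
  have hLinj : Function.Injective L := by
    rw [injective_iff_map_eq_zero]
    intro x hx
    by_contra hx0
    apply hu
    calc u = θ (x⁻¹ * x) u := by rw [inv_mul_cancel₀ hx0, map_one]; rfl
      _ = θ x⁻¹ (L x) := by rw [map_mul]; rfl
      _ = 0 := by rw [hx, map_zero]
  have hLsurj : Function.Surjective L :=
    (LinearMap.injective_iff_surjective_of_finrank_eq_finrank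
      (by rw [hU, GaloisField.finrank p hn])).1 hLinj
  have hcomm : ∀ x, θ x * G = G * θ x := by
    intro x
    have hx : x ∈ Algebra.adjoin (ZMod p) {(α : GaloisField p n)} := by
      rw [adjoin_eq_top_of_generator hα]; trivial
    induction hx using Algebra.adjoin_induction with
    | mem x hx => rw [Set.mem_singleton_iff.1 hx, hθ, hBG, one_smul]
    | algebraMap r => rw [AlgHom.commutes, Algebra.commutes]
    | add x y _ _ hx hy => rw [map_add, add_mul, mul_add, hx, hy]
    | mul x y _ _ hx hy => rw [map_mul, mul_assoc, hy, ← mul_assoc, hx, mul_assoc]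
  ext w
  obtain ⟨x, rfl⟩ := hLsurj w
  calc G (L x) = (G * θ x) u := rfl
    _ = θ x (G u) := by rw [← hcomm]; rfl
    _ = L x := by rw [hGu, hL]

end Field

/-! ### Companion matrices -/

open Polynomial in
theorem aeval_companion {F : Type*} [Field F] {n : ℕ} {m : F[X]} (hm : m.Monic)
    (hdeg : m.natDegree = n) : aeval (companion n m) m = 0 := by
  -- the first row is a cyclic vector: multiplication by powers of the matrix gives all unit rows
  have hrow : ∀ (k : ℕ) (hk : k < n), ∀ h0 : 0 < n,
      ((companion n m) ^ k) ⟨0, h0⟩ = Pi.single ⟨k, hk⟩ 1 := by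
    intro k
    induction k with
    | zero => intro hk h0; ext j; simp [Matrix.one_apply, Pi.single_apply, eq_comm]
    | succ k ih =>
      intro hk h0
      ext j
      rw [pow_succ, Matrix.mul_apply]
      simp only [ih (by omega) h0, Pi.single_apply, ite_mul, one_mul, zero_mul,
        Finset.sum_ite_eq', Finset.mem_univ, if_true]
      simp only [companion, Matrix.of_apply, Fin.ext_iff]
      rw [if_neg (by omega)]
  have hzero : ∀ h0 : 0 < n, (aeval (companion n m) m) ⟨0, h0⟩ = 0 := by
    intro h0
    ext j
    rw [aeval_eq_sum_range, Finset.sum_range_succ, hdeg]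
    have hlast : ((companion n m) ^ n) ⟨0, h0⟩ j = - m.coeff j := by
      obtain ⟨k, rfl⟩ : ∃ k, n = k + 1 := ⟨n - 1, by omega⟩
      rw [pow_succ, Matrix.mul_apply]
      simp only [hrow k (by omega) h0, Pi.single_apply, ite_mul, one_mul, zero_mul,
        Finset.sum_ite_eq', Finset.mem_univ, if_true]
      simp [companion]
    have hcoef : m.coeff n = 1 := by rw [← hdeg]; exact hm
    rw [Matrix.add_apply, Matrix.sum_apply, Matrix.smul_apply, hlast, hcoef,
      Finset.sum_range]
    simp [hrow _ (Fin.isLt _) h0, Pi.single_apply]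
  ext i j
  have h0 : 0 < n := i.pos
  have h : (companion n m ^ (i : ℕ) * aeval (companion n m) m) ⟨0, h0⟩ j = 0 := by
    have hc : companion n m ^ (i : ℕ) * aeval (companion n m) m
        = aeval (companion n m) m * companion n m ^ (i : ℕ) := by
      simpa using congrArg (aeval (companion n m)) (mul_comm (X ^ (i : ℕ)) m)
    rw [hc, Matrix.mul_apply]
    simp [hzero h0]
  rw [Matrix.mul_apply] at h
  simpa [hrow i i.2 h0, Pi.single_apply] using h

theorem aeval_transpose {F : Type*} [Field F] {n : ℕ} (M : Matrix (Fin n) (Fin n) F)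
    (m : Polynomial F) : Polynomial.aeval M.transpose m = (Polynomial.aeval M m).transpose := by
  simp [Polynomial.aeval_eq_sum_range, Matrix.transpose_sum, Matrix.transpose_pow]

/-! ### The exterior square -/

section Exterior

variable {F V N : Type*} [Field F] [AddCommGroup V] [Module F V] [AddCommGroup N] [Module F N]

theorem update_pair_zero {V : Type*} (x y z : V) : Function.update ![x, z] 0 y = ![y, z] := by
  ext i; fin_cases i <;> rfl

theorem update_pair_one {V : Type*} (x y z : V) : Function.update ![z, x] 1 y = ![z, y] := by
  ext i; fin_cases i <;> rfl

theorem wedge_add_left (x y z : V) : wedge (F := F) (x + y) z = wedge x z + wedge y z := by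
  have h := (exteriorPower.ιMulti F 2).map_update_add ![x, z] 0 x y
  rwa [update_pair_zero, update_pair_zero, update_pair_zero] at h

theorem wedge_smul_left (r : F) (x z : V) : wedge (F := F) (r • x) z = r • wedge x z := by
  have h := (exteriorPower.ιMulti F 2).map_update_smul ![x, z] 0 r x
  rwa [update_pair_zero, update_pair_zero] at h

theorem wedge_add_right (x y z : V) : wedge (F := F) z (x + y) = wedge z x + wedge z y := by
  have h := (exteriorPower.ιMulti F 2).map_update_add ![z, x] 1 x y
  rwa [update_pair_one, update_pair_one, update_pair_one] at h

theorem wedge_smul_right (r : F) (x z : V) : wedge (F := F) z (r • x) = r • wedge z x := by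
  have h := (exteriorPower.ιMulti F 2).map_update_smul ![z, x] 1 r x
  rwa [update_pair_one, update_pair_one] at h

@[simp]
theorem wedge_self (x : V) : wedge (F := F) x x = 0 :=
  (exteriorPower.ιMulti F 2).map_eq_zero_of_eq ![x, x] (i := 0) (j := 1) rfl (by decide)

variable (F V) in
/-- The wedge product as a bilinear map. -/
noncomputable def wedgeBilin : V →ₗ[F] V →ₗ[F] ⋀[F]^2 V :=
  LinearMap.mk₂ F wedge wedge_add_left wedge_smul_left (fun z x y => wedge_add_right x y z)
    (fun r z x => wedge_smul_right r x z)

@[simp]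
theorem wedgeBilin_apply (x y : V) : wedgeBilin F V x y = wedge x y := rfl

theorem map_wedge (g : V →ₗ[F] V) (x y : V) :
    exteriorPower.map 2 g (wedge x y) = wedge (g x) (g y) := by
  rw [wedge, wedge, exteriorPower.map_apply_ιMulti]
  congr 1
  ext i
  fin_cases i <;> rfl

theorem exteriorSquare_hom_ext {g h : ⋀[F]^2 V →ₗ[F] N}
    (H : ∀ x y, g (wedge x y) = h (wedge x y)) : g = h := by
  apply exteriorPower.linearMap_ext
  ext m
  have hm : m = ![m 0, m 1] := by ext i; fin_cases i <;> rfl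
  rw [hm]
  exact H _ _

/-- The linear map on the exterior square with `x ∧ y ↦ B x y - B y x`. -/
noncomputable def antisymmetrize (B : V →ₗ[F] V →ₗ[F] N) : ⋀[F]^2 V →ₗ[F] N :=
  exteriorPower.alternatingMapLinearEquiv
    { toFun := fun m => B (m 0) (m 1) - B (m 1) (m 0)
      map_update_add' := by
        intro inst m i x y
        cases Subsingleton.elim inst (instDecidableEqFin 2)
        fin_cases i <;> simp [Function.update] <;> abel
      map_update_smul' := by
        intro inst m i r x
        cases Subsingleton.elim inst (instDecidableEqFin 2)
        fin_cases i <;> simp [Function.update, smul_sub]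
      map_eq_zero_of_eq' := by
        intro m i j h hij
        fin_cases i <;> fin_cases j <;> simp_all }

@[simp]
theorem antisymmetrize_wedge (B : V →ₗ[F] V →ₗ[F] N) (x y : V) :
    antisymmetrize B (wedge x y) = B x y - B y x := by
  simp [antisymmetrize, wedge]

/-- Contraction of the exterior square with a linear form:
`x ∧ y ↦ φ x • y - φ y • x`. -/
noncomputable def contraction (φ : V →ₗ[F] F) : ⋀[F]^2 V →ₗ[F] V :=
  antisymmetrize (LinearMap.lsmul F V ∘ₗ φ)

@[simp]
theorem contraction_wedge (φ : V →ₗ[F] F) (x y : V) :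
    contraction φ (wedge x y) = φ x • y - φ y • x := by
  simp [contraction]

theorem exteriorPower_basis_pair {K : ℕ} (v : Module.Basis (Fin K) F V) {j k : Fin K} (h : j < k)
    (hc : ({j, k} : Finset (Fin K)) ∈ Set.powersetCard (Fin K) 2) :
    v.exteriorPower 2 ⟨{j, k}, hc⟩ = wedge (v j) (v k) := by
  have hm : StrictMono ![j, k] := by
    intro a b hab
    fin_cases a <;> fin_cases b <;> simp_all
  have hs : (⟨{j, k}, hc⟩ : Set.powersetCard (Fin K) 2)
      = Set.powersetCard.ofFinEmbEquiv (OrderEmbedding.ofStrictMono ![j, k] hm) := by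
    apply Subtype.ext
    ext a
    rw [Set.powersetCard.mem_coe_iff, Set.powersetCard.mem_coe_iff]
    simp [Set.powersetCard.mem_ofFinEmbEquiv_iff_mem_range, eq_comm, or_comm]
  rw [exteriorPower.basis_apply, exteriorPower.ιMulti_family, hs, Equiv.symm_apply_apply, wedge]
  congr 1
  ext i
  fin_cases i <;> rfl

/-- The expansion of an element of the exterior square in the basis of the `v j ∧ v k`, `j < k`. -/
theorem sum_wedgeCoord {K : ℕ} (v : Module.Basis (Fin K) F V) (w : ⋀[F]^2 V) :
    ∑ j, ∑ k, (if h : j < k then wedgeCoord v w j k h • wedge (F := F) (v j) (v k) else 0) = w := by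
  let T : (⋀[F]^2 V) →ₗ[F] (⋀[F]^2 V) :=
    { toFun := fun w => ∑ j, ∑ k,
        (if h : j < k then wedgeCoord v w j k h • wedge (F := F) (v j) (v k) else 0)
      map_add' := by
        intro x y
        simp only [← Finset.sum_add_distrib]
        refine Finset.sum_congr rfl fun j _ => Finset.sum_congr rfl fun k _ => ?_
        split_ifs
        · simp [wedgeCoord, add_smul]
        · simp
      map_smul' := by
        intro r x
        simp only [Finset.smul_sum, RingHom.id_apply]
        refine Finset.sum_congr rfl fun j _ => Finset.sum_congr rfl fun k _ => ?_
        split_ifs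
        · simp [wedgeCoord, mul_smul]
        · simp }
  suffices h : T = (LinearMap.id : (⋀[F]^2 V) →ₗ[F] (⋀[F]^2 V)) from by
    exact LinearMap.congr_fun h w
  refine (v.exteriorPower 2).ext ?_
  rintro ⟨s, hs⟩
  obtain ⟨a, b, hab, rfl⟩ : ∃ a b : Fin K, a < b ∧ s = {a, b} := by
    obtain ⟨a, b, hab, rfl⟩ := Finset.card_eq_two.1 (Set.powersetCard.mem_iff.1 hs)
    rcases lt_or_gt_of_ne hab with h | h
    · exact ⟨a, b, h, rfl⟩
    · exact ⟨b, a, h, Finset.pair_comm a b⟩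
  have hT : T (v.exteriorPower 2 ⟨{a, b}, hs⟩) = ∑ j, ∑ k,
      ((if j = a then if k = b then wedge (F := F) (v a) (v b) else 0 else 0) : ⋀[F]^2 V) := by
    simp only [T, LinearMap.coe_mk, AddHom.coe_mk]
    refine Finset.sum_congr rfl fun j _ => Finset.sum_congr rfl fun k _ => ?_
    by_cases hjk : j < k
    · rw [dif_pos hjk, wedgeCoord, Module.Basis.repr_self, Finsupp.single_apply]
      by_cases hja : j = a ∧ k = b
      · obtain ⟨rfl, rfl⟩ := hja
        simp
      · rw [if_neg]
        · rw [zero_smul]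
          split_ifs with h1 h2
          · exact absurd ⟨h1, h2⟩ hja
          · rfl
          · rfl
        · intro h
          have h' : ({a, b} : Finset (Fin K)) = {j, k} := congrArg Subtype.val h
          have hj : j ∈ ({a, b} : Finset (Fin K)) := by rw [h']; simp
          have hk : k ∈ ({a, b} : Finset (Fin K)) := by rw [h']; simp
          simp only [Finset.mem_insert, Finset.mem_singleton] at hj hk
          omega
    · rw [dif_neg hjk]
      split_ifs with h1 h2
      · exact absurd (h1 ▸ h2 ▸ hab) hjk
      · rfl
      · rfl
  rw [hT]
  simp [exteriorPower_basis_pair v hab]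

end Exterior

/-! ### Maps that intertwine `f` with its exterior square -/

section Rigidity

variable {F V U : Type*} [Field F] [AddCommGroup V] [Module F V] [AddCommGroup U] [Module F U]
  [FiniteDimensional F U] [FiniteDimensional F V]

/-- The space `V` is split as the sum of the line through `v₀` and `U`, by means of the coordinate
`ε`, the inclusion `inc` and the projection `pr`. The hypothesis `contraction ε C = 0` says that `C`
lies in the exterior square of `U`. -/
theorem block_rigidity (hU : 3 ≤ Module.finrank F U) {ε : V →ₗ[F] F} {inc : U →ₗ[F] V}
    {pr : V →ₗ[F] U} {v₀ : V} (hε₀ : ε v₀ = 1) (hεi : ∀ u, ε (inc u) = 0)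
    (hpr₀ : pr v₀ = 0) (hpi : ∀ u, pr (inc u) = u) (hdec : ∀ x, ε x • v₀ + inc (pr x) = x)
    {B : U →ₗ[F] U} (hB : Function.Injective B) {b : U} {C : ⋀[F]^2 V} (hC : C ≠ 0)
    (hεC : contraction ε C = 0) {f : V →ₗ[F] ⋀[F]^2 V} (hf₀ : f v₀ = wedge v₀ (inc b) + C)
    (hf : ∀ u, f (inc u) = wedge v₀ (inc (B u))) {g : V →ₗ[F] V} (hg : Function.Injective g)
    (hfg : ∀ x, f (g x) = exteriorPower.map 2 g (f x)) :
    ∃ (l : F) (G : U →ₗ[F] U), l ≠ 0 ∧ g v₀ = l • v₀ ∧ (∀ u, g (inc u) = inc (G u)) ∧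
      (∀ u, B (G u) = l • G (B u)) ∧ G b = b := by
  have hinc : Function.Injective inc := fun x y h => by rw [← hpi x, h, hpi]
  have hv₀ : v₀ ≠ 0 := by rintro rfl; simp at hε₀
  have hfg' : ∀ u, f (g (inc u)) = wedge (g v₀) (g (inc (B u))) := by
    intro u; rw [hfg, hf, map_wedge]
  have hline : pr (g v₀) = 0 := by
    by_contra hne
    -- Otherwise `v₀ ∧ V` and `g v₀ ∧ V` meet in a line, so that `B` maps the subspace of the
    -- `u ∈ U` with `g u ∈ U`, of dimension at least `dim U - 1 ≥ 2`, into the line through `pr y`.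
    obtain ⟨χ, hχ⟩ : ∃ χ : Module.Dual F U, χ (pr (g v₀)) ≠ 0 := by
      by_contra! h
      exact hne ((Module.forall_dual_apply_eq_zero_iff F _).1 h)
    obtain ⟨y, hy⟩ := (LinearMap.injective_iff_surjective (f := g)).1 hg v₀
    have hmap : (LinearMap.ker (ε ∘ₗ g ∘ₗ inc)).map B ≤ Submodule.span F {pr y} := by
      rintro _ ⟨u, hu, rfl⟩
      have hu' : g (inc u) = inc (pr (g (inc u))) := by
        have hu0 : ε (g (inc u)) = 0 := hu
        conv_lhs => rw [← hdec (g (inc u)), hu0, zero_smul, zero_add]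
      have h1 := hfg' u
      rw [hu', hf] at h1
      have h2 := congrArg (contraction (χ ∘ₗ pr)) h1
      simp only [contraction_wedge, LinearMap.comp_apply, hpr₀, hpi, map_zero, zero_smul,
        zero_sub] at h2
      set s := χ (B (pr (g (inc u))))
      set t := χ (pr (g (inc (B u))))
      set r := χ (pr (g v₀))
      have h3 : r • inc (B u) = t • v₀ - s • y := by
        apply hg
        rw [map_sub, map_smul, map_smul, map_smul, hy, sub_eq_add_neg, h2]
        abel
      have h4 := congrArg pr h3
      rw [map_sub, map_smul, map_smul, map_smul, hpi, hpr₀, smul_zero, zero_sub] at h4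
      rw [Submodule.mem_span_singleton]
      refine ⟨-(r⁻¹ * s), ?_⟩
      rw [neg_smul, mul_smul, ← smul_neg, ← h4, inv_smul_smul₀ hχ]
    have h1 := Submodule.finrank_mono hmap
    rw [← (Submodule.equivMapOfInjective B hB _).finrank_eq] at h1
    have h2 : Module.finrank F (Submodule.span F {pr y}) ≤ 1 :=
      (finrank_span_le_card _).trans_eq (by simp)
    have h3 := LinearMap.finrank_range_add_finrank_ker (ε ∘ₗ g ∘ₗ inc)
    have h4 := Submodule.finrank_le (LinearMap.range (ε ∘ₗ g ∘ₗ inc))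
    rw [Module.finrank_self] at h4
    omega
  set l := ε (g v₀) with hl_def
  have hgv : g v₀ = l • v₀ := by
    conv_lhs => rw [← hdec (g v₀), hline, map_zero, add_zero]
  have hl : l ≠ 0 := by
    intro h
    rw [h, zero_smul] at hgv
    exact hv₀ (hg (by rw [hgv, map_zero]))
  -- an element of `v₀ ∧ V` that `ε` contracts to zero vanishes
  have hvan : ∀ y, contraction ε (wedge v₀ y) = 0 → wedge (F := F) v₀ y = 0 := by
    intro y hy
    rw [contraction_wedge, hε₀, one_smul, sub_eq_zero] at hy
    rw [hy, wedge_smul_right, wedge_self, smul_zero]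
  -- `g` preserves `U`: a component along `v₀` would put a nonzero multiple of `C` into `v₀ ∧ V`
  have hεg : ∀ u, ε (g (inc u)) = 0 := by
    intro u
    set a := ε (g (inc u))
    have h1 := hfg' u
    rw [← hdec (g (inc u)), map_add, map_smul, hf₀, hf, hgv, smul_add, ← wedge_smul_right,
      wedge_smul_left, ← wedge_smul_right] at h1
    have h2 : a • C = wedge (F := F) v₀ (l • g (inc (B u)) - a • inc b
        - inc (B (pr (g (inc u))))) := by
      rw [← wedgeBilin_apply, map_sub, map_sub]
      simp only [wedgeBilin_apply]
      rw [← h1]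
      abel
    have h3 : a • C = 0 := by
      rw [h2]
      apply hvan
      rw [← h2, map_smul, hεC, smul_zero]
    exact (smul_eq_zero.1 h3).resolve_right hC
  have hgi : ∀ u, g (inc u) = inc ((pr ∘ₗ g ∘ₗ inc) u) := by
    intro u
    conv_lhs => rw [← hdec (g (inc u)), hεg, zero_smul, zero_add]
    rfl
  refine ⟨l, pr ∘ₗ g ∘ₗ inc, hl, hgv, hgi, ?_, ?_⟩
  · intro u
    have h1 := congrArg (contraction ε) (hfg' u)
    rw [hgi u, hf, hgi (B u), hgv, contraction_wedge, contraction_wedge, map_smul, hε₀, hεi, hεi,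
      zero_smul, zero_smul, sub_zero, sub_zero, one_smul, smul_eq_mul, mul_one, ← map_smul] at h1
    exact hinc h1
  · -- `⋀² g C` lies in the exterior square of `U` too, so only the terms with `v₀` survive below
    have hcg : contraction ε (exteriorPower.map 2 g C) = 0 := by
      have h : contraction ε ∘ₗ exteriorPower.map 2 g = l • (g ∘ₗ contraction ε) := by
        have hεl : ∀ x, ε (g x) = l * ε x := by
          intro x
          conv_lhs => rw [← hdec x]
          simp [hεg, mul_comm, hl_def]
        apply exteriorSquare_hom_ext
        intro x y
        simp [map_wedge, hεl, smul_sub, mul_smul]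
      have h' := LinearMap.congr_fun h C
      simpa [hεC] using h'
    have h1 := congrArg (contraction ε) (hfg v₀)
    rw [hgv, map_smul, hf₀, map_add, map_wedge, map_smul, map_add, map_add, hcg, hεC, hgi, hgv,
      contraction_wedge, contraction_wedge, map_smul, hε₀, hεi, hεi,
      zero_smul, zero_smul, sub_zero, sub_zero, one_smul, smul_eq_mul, mul_one, add_zero,
      add_zero] at h1
    exact (hinc (smul_right_injective V hl h1)).symm

end Rigidity

section Coordinates

variable {F V : Type*} [Field F] [AddCommGroup V] [Module F V] {n : ℕ}

theorem coord_contraction_wedge_basis (v : Module.Basis (Fin (n + 1)) F V) (a b j k : Fin (n + 1)) :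
    v.coord b (contraction (v.coord a) (wedge (v j) (v k)))
      = (if j = a then 1 else 0) * (if k = b then 1 else 0)
        - (if k = a then 1 else 0) * (if j = b then 1 else 0) := by
  simp only [contraction_wedge, map_sub, map_smul, Module.Basis.coord_apply,
    Module.Basis.repr_self, Finsupp.single_apply, smul_eq_mul]

theorem sum_smul_wedge_succ_ne_zero (v : Module.Basis (Fin (n + 1)) F V)
    {c : {q : Fin n × Fin n // q.1 < q.2} → F} (hc : c ≠ 0) :
    ∑ q, c q • wedge (F := F) (v q.1.1.succ) (v q.1.2.succ) ≠ 0 := by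
  intro h
  apply hc
  ext q
  have h1 := congrArg
    (fun w => v.coord q.1.2.succ (contraction (v.coord q.1.1.succ) w)) h
  simp only [map_sum, map_smul, coord_contraction_wedge_basis, map_zero, Fin.succ_inj] at h1
  rw [Finset.sum_eq_single q] at h1
  · have hne : q.1.2 ≠ q.1.1 := q.2.ne'
    simpa [hne] using h1
  · intro r _ hr
    have hr1 : ¬ (r.1.1 = q.1.1 ∧ r.1.2 = q.1.2) := fun h =>
      hr (Subtype.ext (Prod.ext h.1 h.2))
    have hr2 : ¬ (r.1.2 = q.1.1 ∧ r.1.1 = q.1.2) := fun h => by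
      have h3 := r.2
      have h4 := q.2
      rw [h.1, h.2] at h3
      exact lt_asymm h3 h4
    rw [ite_zero_mul_ite_zero, ite_zero_mul_ite_zero, if_neg hr1, if_neg hr2, sub_zero, smul_zero]
  · simp

theorem contraction_coord_zero_sum (v : Module.Basis (Fin (n + 1)) F V)
    (c : {q : Fin n × Fin n // q.1 < q.2} → F) :
    contraction (v.coord 0) (∑ q, c q • wedge (F := F) (v q.1.1.succ) (v q.1.2.succ)) = 0 := by
  rw [map_sum]
  refine Finset.sum_eq_zero fun q _ => ?_
  simp [Module.Basis.repr_self]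

end Coordinates

/-- A linear automorphism of `V` compatible with `f` is the identity. Both conventions for the
companion matrix are covered, since the proof uses only that the minimal polynomial of `α`
annihilates `A`. -/
theorem eq_id_of_intertwines {p : ℕ} [Fact p.Prime] {n : ℕ} (hn : 3 ≤ n)
    {V : Type*} [AddCommGroup V] [Module (ZMod p) V]
    (v : Module.Basis (Fin (n + 1)) (ZMod p) V)
    {α : (GaloisField p n)ˣ} (hα : ∀ x : (GaloisField p n)ˣ, x ∈ Subgroup.zpowers α)
    {b : Fin n → ZMod p} (hb : b ≠ 0)
    {c : {q : Fin n × Fin n // q.1 < q.2} → ZMod p} (hc : c ≠ 0)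
    {A : Matrix (Fin n) (Fin n) (ZMod p)}
    (hA : A = companion n (minpoly (ZMod p) (α : GaloisField p n)) ∨
      A = (companion n (minpoly (ZMod p) (α : GaloisField p n))).transpose)
    {f : V →ₗ[ZMod p] ⋀[ZMod p]^2 V} (hf : HasBlockMatrix v f b c A)
    {g : V →ₗ[ZMod p] V} (hg : Function.Injective g)
    (hfg : ∀ x, f (g x) = exteriorPower.map 2 g (f x)) : g = LinearMap.id := by
  have hn0 : n ≠ 0 := by omega
  have : FiniteDimensional (ZMod p) V := v.finiteDimensional_of_finite
  set m := minpoly (ZMod p) (α : GaloisField p n) with hm_def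
  have hm : m.Monic := minpoly.monic (Algebra.IsIntegral.isIntegral _)
  have hdeg : m.natDegree = n := natDegree_minpoly_generator hn0 hα
  have hAt : Polynomial.aeval A.transpose m = 0 := by
    rcases hA with rfl | rfl
    · rw [aeval_transpose, aeval_companion hm hdeg, Matrix.transpose_zero]
    · rw [Matrix.transpose_transpose, aeval_companion hm hdeg]
  -- rows of `A` are images of basis vectors, hence the transpose
  let B : Module.End (ZMod p) (Fin n → ZMod p) := Matrix.toLinAlgEquiv' A.transpose
  have hBm : Polynomial.aeval B m = 0 := by
    rw [Polynomial.aeval_algHom_apply, hAt, map_zero]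
  have hB : Function.Injective B := by
    obtain ⟨θ, hθ⟩ := exists_algHom_generator hα hBm
    have h1 : θ ((α⁻¹ : (GaloisField p n)ˣ) : GaloisField p n) * B = 1 := by
      rw [← hθ, ← map_mul, Units.inv_mul, map_one]
    intro x y hxy
    have h2 := congrArg (θ ((α⁻¹ : (GaloisField p n)ˣ) : GaloisField p n)) hxy
    simpa only [← Module.End.mul_apply, h1, Module.End.one_apply] using h2
  let inc : (Fin n → ZMod p) →ₗ[ZMod p] V :=
    Fintype.linearCombination (ZMod p) (fun i : Fin n => v i.succ)
  have hinc : ∀ u, inc u = ∑ i, u i • v i.succ := fun u => rfl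
  let pr : V →ₗ[ZMod p] (Fin n → ZMod p) := LinearMap.pi fun i => v.coord i.succ
  have hpr : ∀ x i, pr x i = v.repr x i.succ := fun _ _ => rfl
  have hwinc : ∀ u, wedge (F := ZMod p) (v 0) (inc u) = ∑ i, u i • wedge (v 0) (v i.succ) := by
    intro u
    rw [← wedgeBilin_apply, hinc, map_sum]
    simp
  obtain ⟨l, G, hl, hg0, hgi, hBG, hGb⟩ := block_rigidity (ε := v.coord 0) (inc := inc) (pr := pr)
    (v₀ := v 0) (B := B) (b := b)
    (C := ∑ q, c q • wedge (F := ZMod p) (v q.1.1.succ) (v q.1.2.succ)) (f := f) (g := g)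
    (by simpa using hn) (by simp)
    (fun u => by simp [hinc, Module.Basis.repr_self])
    (by ext i; simp [hpr])
    (fun u => by ext i; simp [hpr, hinc, Finsupp.single_apply])
    (fun x => by
      rw [hinc]
      conv_rhs => rw [← v.sum_repr x, Fin.sum_univ_succ]
      rfl)
    hB (sum_smul_wedge_succ_ne_zero v hc) (contraction_coord_zero_sum v c)
    (by rw [hf.1, hwinc])
    (fun u => by
      rw [hwinc, hinc, map_sum]
      simp only [map_smul, hf.2, Finset.smul_sum]
      rw [Finset.sum_comm]
      refine Finset.sum_congr rfl fun j _ => ?_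
      simp only [smul_smul, ← Finset.sum_smul]
      congr 1
      simp [B, Matrix.toLinAlgEquiv'_apply, Matrix.mulVec, dotProduct, mul_comm])
    hg hfg
  have hGinj : Function.Injective G := by
    intro x y hxy
    have h1 : inc x = inc y := hg (by rw [hgi, hgi, hxy])
    have h2 := congrArg pr h1
    have hpi : ∀ u, pr (inc u) = u := fun u => by
      ext i; simp [hpr, hinc, Finsupp.single_apply]
    rwa [hpi, hpi] at h2
  obtain ⟨rfl, rfl⟩ := semilinear_rigidity hn0 hα (by simp) hBm hGinj hl
    (LinearMap.ext hBG) hb hGb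
  refine v.ext fun i => ?_
  refine Fin.cases ?_ (fun i => ?_) i
  · rw [hg0, one_smul]; rfl
  · have h1 := hgi (Pi.single i 1)
    have h2 : inc (Pi.single i 1) = v i.succ := by
      simp [hinc, Pi.single_apply]
    rw [Module.End.one_apply, h2] at h1
    exact h1

theorem wedge_swap {F V : Type*} [Field F] [AddCommGroup V] [Module F V] (x y : V) :
    wedge (F := F) x y = -wedge y x := by
  have h := wedge_self (F := F) (x + y)
  rw [wedge_add_left, wedge_add_right, wedge_add_right, wedge_self, wedge_self, zero_add,
    add_zero] at h
  exact eq_neg_of_add_eq_zero_left h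

/-- The wedge product is the antisymmetrization of a bilinear map, also in characteristic two: take
`v i ∧ v j` for `i < j` and zero for the other pairs of basis vectors. -/
theorem exists_bilin_sub_flip_eq_wedge {F V : Type*} [Field F] [AddCommGroup V] [Module F V]
    {N : ℕ} (v : Module.Basis (Fin N) F V) :
    ∃ β : V →ₗ[F] V →ₗ[F] ⋀[F]^2 V, ∀ x y, β x y - β y x = wedge x y := by
  let β : V →ₗ[F] V →ₗ[F] ⋀[F]^2 V := v.constr F fun i => v.constr F fun j =>
    if i < j then wedge (v i) (v j) else 0
  have hβ : ∀ i j, β (v i) (v j) = if i < j then wedge (v i) (v j) else 0 := by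
    intro i j
    simp only [β, Module.Basis.constr_basis]
  refine ⟨β, fun x y => ?_⟩
  have h : β = wedgeBilin F V + β.flip := by
    refine v.ext fun i => v.ext fun j => ?_
    simp only [LinearMap.add_apply, LinearMap.flip_apply, hβ, wedgeBilin_apply]
    rcases lt_trichotomy i j with h | rfl | h
    · rw [if_pos h, if_neg h.asymm, add_zero]
    · simp
    · rw [if_neg h.asymm, if_pos h, wedge_swap (v i), neg_add_cancel]
  rw [sub_eq_iff_eq_add]
  exact LinearMap.congr_fun (LinearMap.congr_fun h x) y

/-! ### A group realizing the presentation -/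

/-- The central extension of `M` by `W` with cocycle a biadditive map `β`. -/
@[ext]
structure CocycleExt {M W : Type*} [AddCommGroup M] [AddCommGroup W] (β : M →+ M →+ W) where
  /-- The component in the quotient. -/
  fst : M
  /-- The component in the central subgroup. -/
  snd : W

namespace CocycleExt

variable {M W : Type*} [AddCommGroup M] [AddCommGroup W] {β : M →+ M →+ W}

instance : Mul (CocycleExt β) := ⟨fun x y => ⟨x.fst + y.fst, x.snd + y.snd + β x.fst y.fst⟩⟩

instance : One (CocycleExt β) := ⟨⟨0, 0⟩⟩

instance : Inv (CocycleExt β) := ⟨fun x => ⟨-x.fst, -x.snd + β x.fst x.fst⟩⟩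

@[simp] theorem mul_fst (x y : CocycleExt β) : (x * y).fst = x.fst + y.fst := rfl

@[simp] theorem mul_snd (x y : CocycleExt β) :
    (x * y).snd = x.snd + y.snd + β x.fst y.fst := rfl

@[simp] theorem one_fst : (1 : CocycleExt β).fst = 0 := rfl

@[simp] theorem one_snd : (1 : CocycleExt β).snd = 0 := rfl

@[simp] theorem inv_fst (x : CocycleExt β) : (x⁻¹).fst = -x.fst := rfl

@[simp] theorem inv_snd (x : CocycleExt β) : (x⁻¹).snd = -x.snd + β x.fst x.fst := rfl

instance : Group (CocycleExt β) :=
  Group.ofLeftAxioms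
    (fun x y z => by ext <;> simp <;> abel)
    (fun x => by ext <;> simp)
    (fun x => by ext <;> simp)

theorem commutator_fst (x y : CocycleExt β) : ⁅x, y⁆.fst = 0 := by
  simp [commutatorElement_def]

theorem commutator_snd (x y : CocycleExt β) :
    ⁅x, y⁆.snd = β x.fst y.fst - β y.fst x.fst := by
  simp [commutatorElement_def]
  abel

theorem pow_fst (x : CocycleExt β) (k : ℕ) : (x ^ k).fst = k • x.fst := by
  induction k with
  | zero => simp
  | succ k ih => rw [pow_succ, mul_fst, ih, succ_nsmul]

theorem pow_snd (x : CocycleExt β) (k : ℕ) :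
    (x ^ k).snd = k • x.snd + k.choose 2 • β x.fst x.fst := by
  induction k with
  | zero => simp
  | succ k ih =>
    rw [pow_succ, mul_snd, ih, pow_fst, map_nsmul, AddMonoidHom.nsmul_apply, succ_nsmul,
      Nat.choose_succ_succ' k 1, Nat.choose_one_right, add_smul]
    abel

/-- The central subgroup, as the image of a homomorphism. -/
def inr : Multiplicative W →* CocycleExt β where
  toFun w := ⟨0, w.toAdd⟩
  map_one' := rfl
  map_mul' x y := by ext <;> simp

@[simp] theorem inr_fst (w : Multiplicative W) : (inr (β := β) w).fst = 0 := rfl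

@[simp] theorem inr_snd (w : Multiplicative W) : (inr (β := β) w).snd = w.toAdd := rfl

/-- The projection onto the quotient. -/
def proj : CocycleExt β →* Multiplicative M where
  toFun x := Multiplicative.ofAdd x.fst
  map_one' := rfl
  map_mul' _ _ := rfl

/-- For `q` annihilating `W` and an additive map `φ`, the subgroup of the pairs `(q u, -φ u)`;
dividing by it identifies `(q u, 0)` with `(0, φ u)`. -/
def powSubgroup (q : ℕ) (φ : M →+ W) (hq : ∀ x : W, q • x = 0) : Subgroup (CocycleExt β) where
  carrier := {x | ∃ u, x.fst = q • u ∧ x.snd = -φ u}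
  one_mem' := ⟨0, by simp⟩
  mul_mem' := by
    rintro x y ⟨u, hu, hu'⟩ ⟨t, ht, ht'⟩
    refine ⟨u + t, ?_, ?_⟩
    · rw [mul_fst, hu, ht, smul_add]
    · rw [mul_snd, hu', ht', hu, map_nsmul, AddMonoidHom.nsmul_apply, hq, map_add]
      abel
  inv_mem' := by
    rintro x ⟨u, hu, hu'⟩
    refine ⟨-u, ?_, ?_⟩
    · rw [inv_fst, hu, smul_neg]
    · rw [inv_snd, hu', hu, map_nsmul, hq, map_neg]
      abel

instance powSubgroup_normal (q : ℕ) (φ : M →+ W) (hq : ∀ x : W, q • x = 0) :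
    (powSubgroup (β := β) q φ hq).Normal := by
  constructor
  rintro x ⟨u, hu, hu'⟩ y
  refine ⟨u, ?_, ?_⟩
  · simp [hu]
  · simp [hu, hu', hq]
    abel

end CocycleExt

section Model

universe u

variable {p N : ℕ} [Fact p.Prime] {V : Type u} [AddCommGroup V] [Module (ZMod p) V]

theorem dvd_powExp (p : ℕ) : p ∣ powExp p := by
  unfold powExp
  split_ifs with h
  · exact ⟨2, by omega⟩
  · exact dvd_rfl

theorem powExp_ne_zero : powExp p ≠ 0 := by
  unfold powExp
  split_ifs
  · norm_num
  · exact (Fact.out : p.Prime).ne_zero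

omit [Fact p.Prime] in
/-- The reason for the exponent `4` when `p = 2`: the term `q.choose 2` in the `q`-th power of a
product has to vanish modulo `p`. -/
theorem dvd_choose_powExp (hp : p.Prime) : p ∣ (powExp p).choose 2 := by
  unfold powExp
  split_ifs with h
  · rw [h]; decide
  · exact hp.dvd_choose_self (by norm_num) (lt_of_le_of_ne hp.two_le (Ne.symm h))

theorem nsmul_eq_zero_of_dvd {M : Type*} [AddCommGroup M] [Module (ZMod p) M] {k : ℕ}
    (h : p ∣ k) (x : M) : k • x = 0 := by
  rw [← Nat.cast_smul_eq_nsmul (ZMod p), (ZMod.natCast_eq_zero_iff k p).2 h, zero_smul]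

/-- There is a group `E` over `V`, containing `W = ⋀² V`, in which commutators are wedges and the
`q`-th power map is `f`. -/
theorem exists_model (v : Module.Basis (Fin N) (ZMod p) V) (f : V →ₗ[ZMod p] ⋀[ZMod p]^2 V) :
    ∃ (E : Type u) (_ : Group E) (ε : E →* Multiplicative V)
      (ι : Multiplicative (⋀[ZMod p]^2 V) →* E) (X : Fin N → E), Function.Injective ι ∧
      (∀ i, ε (X i) = Multiplicative.ofAdd (v i)) ∧
      (∀ x y, ⁅x, y⁆ = ι (Multiplicative.ofAdd (wedge (ε x).toAdd (ε y).toAdd))) ∧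
      (∀ x, x ^ powExp p = ι (Multiplicative.ofAdd (f (ε x).toAdd))) ∧
      ∀ w, ε (ι w) = 1 := by
  obtain ⟨β, hβ⟩ := exists_bilin_sub_flip_eq_wedge v
  let r : (Fin N → ℤ) →+ V := (Fintype.linearCombination ℤ v).toAddMonoidHom
  have hr : ∀ i, r (Pi.single i 1) = v i := fun i => by
    simp [r, Fintype.linearCombination_apply_single]
  let β' : (Fin N → ℤ) →+ (Fin N → ℤ) →+ ⋀[ZMod p]^2 V :=
    AddMonoidHom.mk' (fun u => (β (r u)).toAddMonoidHom.comp r) (fun x y => by ext; simp)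
  have hβ' : ∀ u t, β' u t = β (r u) (r t) := fun _ _ => rfl
  let φ : (Fin N → ℤ) →+ ⋀[ZMod p]^2 V := f.toAddMonoidHom.comp r
  have hφ : ∀ u, φ u = f (r u) := fun _ => rfl
  have hqV : ∀ x : V, powExp p • x = 0 := nsmul_eq_zero_of_dvd (dvd_powExp p)
  have hq : ∀ x : ⋀[ZMod p]^2 V, powExp p • x = 0 := nsmul_eq_zero_of_dvd (dvd_powExp p)
  have hc : ∀ x : ⋀[ZMod p]^2 V, (powExp p).choose 2 • x = 0 :=
    nsmul_eq_zero_of_dvd (dvd_choose_powExp Fact.out)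
  let K : Subgroup (CocycleExt β') := CocycleExt.powSubgroup (powExp p) φ hq
  let ε : CocycleExt β' ⧸ K →* Multiplicative V :=
    QuotientGroup.lift K ((AddMonoidHom.toMultiplicative r).comp CocycleExt.proj) (by
      rintro x ⟨u, hu, -⟩
      change Multiplicative.ofAdd (r x.fst) = 1
      rw [hu, map_nsmul, hqV]
      rfl)
  have hε : ∀ x : CocycleExt β', ε (x : CocycleExt β' ⧸ K) = Multiplicative.ofAdd (r x.fst) :=
    fun _ => rfl
  refine ⟨CocycleExt β' ⧸ K, inferInstance, ε, (QuotientGroup.mk' K).comp CocycleExt.inr,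
    fun i => QuotientGroup.mk' K ⟨Pi.single i 1, 0⟩, ?_, ?_, ?_, ?_, ?_⟩
  · rw [injective_iff_map_eq_one]
    intro w hw
    obtain ⟨u, hu, hu'⟩ := (QuotientGroup.eq_one_iff _).1 hw
    -- `M = ℤ ^ N` is torsion-free, so the subgroup divided by meets `W` trivially
    have hu0 : u = 0 := (smul_eq_zero.1 hu.symm).resolve_left powExp_ne_zero
    rw [hu0, map_zero, neg_zero] at hu'
    exact hu'
  · intro i
    exact congrArg Multiplicative.ofAdd (hr i)
  · intro x y
    obtain ⟨x, rfl⟩ := QuotientGroup.mk'_surjective K x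
    obtain ⟨y, rfl⟩ := QuotientGroup.mk'_surjective K y
    rw [← map_commutatorElement, MonoidHom.comp_apply]
    congr 1
    apply CocycleExt.ext
    · rw [CocycleExt.commutator_fst]; rfl
    · rw [CocycleExt.commutator_snd, hβ', hβ', hβ]; rfl
  · intro x
    obtain ⟨x, rfl⟩ := QuotientGroup.mk'_surjective K x
    rw [← map_pow, MonoidHom.comp_apply, eq_comm]
    refine QuotientGroup.eq.2 ⟨x.fst, ?_, ?_⟩
    · simp [CocycleExt.pow_fst]
    · rw [CocycleExt.mul_snd, CocycleExt.pow_snd, hq, hc]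
      simp [hφ, hε]
  · intro w
    rw [MonoidHom.comp_apply]
    change Multiplicative.ofAdd (r 0) = 1
    rw [map_zero]; rfl

end Model

/-! ### Groups whose commutators are central -/

section ClassTwo

variable {G : Type*} [Group G] {S : Set G}

theorem mem_center_of_commute_generators (hS : Subgroup.closure S = ⊤) {a : G}
    (h : ∀ s ∈ S, Commute s a) : a ∈ Subgroup.center G := by
  rw [Subgroup.mem_center_iff]
  intro g
  have hg : g ∈ Subgroup.closure S := hS ▸ Subgroup.mem_top g
  have hle : Subgroup.closure S ≤ Subgroup.centralizer {a} := by
    rw [Subgroup.closure_le]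
    intro s hs
    exact Subgroup.mem_centralizer_singleton_iff.2 (h s hs)
  exact Subgroup.mem_centralizer_singleton_iff.1 (hle hg)

theorem commutator_mem_center_of_generators (hS : Subgroup.closure S = ⊤)
    (h : ∀ s ∈ S, ∀ t ∈ S, ⁅s, t⁆ ∈ Subgroup.center G) (a b : G) :
    ⁅a, b⁆ ∈ Subgroup.center G := by
  let π := QuotientGroup.mk' (Subgroup.center G)
  have hS' : Subgroup.closure (π '' S) = ⊤ := by
    rw [← MonoidHom.map_closure, hS, ← MonoidHom.range_eq_map]
    exact MonoidHom.range_eq_top.2 (QuotientGroup.mk'_surjective _)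
  have hgen : π '' S ⊆ Subgroup.center (G ⧸ Subgroup.center G) := by
    rintro _ ⟨t, ht, rfl⟩
    refine mem_center_of_commute_generators hS' ?_
    rintro _ ⟨s, hs, rfl⟩
    rw [← commutatorElement_eq_one_iff_commute, ← map_commutatorElement]
    exact (QuotientGroup.eq_one_iff _).2 (h s hs t ht)
  have htop : π b ∈ Subgroup.center (G ⧸ Subgroup.center G) := by
    have hle := (Subgroup.closure_le _).2 hgen
    rw [hS'] at hle
    exact hle (Subgroup.mem_top _)
  have h1 : π ⁅a, b⁆ = 1 := by
    rw [map_commutatorElement, commutatorElement_eq_one_iff_commute]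
    exact Subgroup.mem_center_iff.1 htop (π a)
  exact (QuotientGroup.eq_one_iff _).1 h1

theorem commutator_mul_left_of_central (h : ∀ a b : G, ⁅a, b⁆ ∈ Subgroup.center G) (a b c : G) :
    ⁅a * b, c⁆ = ⁅a, c⁆ * ⁅b, c⁆ := by
  have h1 : ⁅a * b, c⁆ = a * ⁅b, c⁆ * a⁻¹ * ⁅a, c⁆ := by
    simp only [commutatorElement_def]; group
  rw [h1, Subgroup.mem_center_iff.1 (h b c) a, mul_inv_cancel_right,
    Subgroup.mem_center_iff.1 (h b c)]

theorem commutator_pow_left_of_central (h : ∀ a b : G, ⁅a, b⁆ ∈ Subgroup.center G) (a b : G)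
    (k : ℕ) : ⁅a ^ k, b⁆ = ⁅a, b⁆ ^ k := by
  induction k with
  | zero => simp
  | succ k ih => rw [pow_succ, commutator_mul_left_of_central h, ih, pow_succ]

theorem commutator_pow_eq_one_of_generators (h : ∀ a b : G, ⁅a, b⁆ ∈ Subgroup.center G)
    (hS : Subgroup.closure S = ⊤) {k : ℕ} (hk : ∀ s ∈ S, ∀ t ∈ S, ⁅s, t⁆ ^ k = 1) (a b : G) :
    ⁅a, b⁆ ^ k = 1 := by
  have step : ∀ c : G, (∀ s ∈ S, ⁅s, c⁆ ^ k = 1) → ∀ a : G, ⁅a, c⁆ ^ k = 1 := by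
    intro c hc a
    have hcomm : c ^ k ∈ Subgroup.center G := by
      refine mem_center_of_commute_generators hS fun s hs => Commute.symm ?_
      rw [← commutatorElement_eq_one_iff_commute, commutator_pow_left_of_central h,
        ← commutatorElement_inv, inv_pow, hc s hs, inv_one]
    rw [← commutatorElement_inv, inv_pow, ← commutator_pow_left_of_central h,
      commutatorElement_eq_one_iff_commute.2 (Subgroup.mem_center_iff.1 hcomm a).symm, inv_one]
  refine step b (fun s hs => ?_) a
  rw [← commutatorElement_inv, inv_pow, step s (fun t ht => hk t ht s hs) b, inv_one]

theorem pow_eq_one_of_mem_commutator (h : ∀ a b : G, ⁅a, b⁆ ∈ Subgroup.center G) {k : ℕ}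
    (hk : ∀ a b : G, ⁅a, b⁆ ^ k = 1) {w : G} (hw : w ∈ commutator G) : w ^ k = 1 := by
  let T : Subgroup G :=
    { carrier := {w | w ∈ Subgroup.center G ∧ w ^ k = 1}
      one_mem' := ⟨one_mem _, one_pow _⟩
      mul_mem' := by
        rintro x y ⟨hx, hx'⟩ ⟨hy, hy'⟩
        refine ⟨mul_mem hx hy, ?_⟩
        rw [Commute.mul_pow (Subgroup.mem_center_iff.1 hy x), hx', hy', one_mul]
      inv_mem' := by
        rintro x ⟨hx, hx'⟩
        exact ⟨inv_mem hx, by rw [inv_pow, hx', inv_one]⟩ }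
  have hle : commutator G ≤ T := by
    rw [commutator_def, Subgroup.commutator_le]
    exact fun a _ b _ => ⟨h a b, hk a b⟩
  exact (hle hw).2

end ClassTwo

/-! ### The presented group -/

section Presented

universe u

variable {p N : ℕ} [Fact p.Prime] {V : Type u} [AddCommGroup V] [Module (ZMod p) V]

/-- The value of the word `commWord v w` under a homomorphism for which the commutators of the
images of the generators lie in the image of an abelian group. -/
theorem map_commWord (v : Module.Basis (Fin N) (ZMod p) V) (w : ⋀[ZMod p]^2 V)
    {G A : Type*} [Group G] [AddCommGroup A] (χ : FreeGroup (Fin N) →* G)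
    (ι : Multiplicative A →* G) (d : Fin N → Fin N → A)
    (h : ∀ j k, ⁅χ (FreeGroup.of j), χ (FreeGroup.of k)⁆ = ι (Multiplicative.ofAdd (d j k))) :
    χ (commWord v w) = ι (Multiplicative.ofAdd
      (∑ j, ∑ k, if h : j < k then (wedgeCoord v w j k h).val • d j k else 0)) := by
  simp only [commWord, ofAdd_sum, ← List.prod_ofFn, map_list_prod, List.map_ofFn]
  congr 2
  ext1 j
  simp only [Function.comp_apply, map_list_prod, List.map_ofFn]
  congr 2
  ext1 k
  simp only [Function.comp_apply]
  split_ifs with hjk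
  · rw [map_pow, map_commutatorElement, h, ← map_pow, ofAdd_nsmul]
  · rw [map_one, ofAdd_zero, map_one]

variable (v : Module.Basis (Fin N) (ZMod p) V) (f : V →ₗ[ZMod p] ⋀[ZMod p]^2 V)

theorem PGroup.commutator_mem_center (a b : PGroup v f) :
    ⁅a, b⁆ ∈ Subgroup.center (PGroup v f) := by
  refine commutator_mem_center_of_generators (PresentedGroup.closure_range_of (relators v f)) ?_ a b
  rintro _ ⟨i, rfl⟩ _ ⟨j, rfl⟩
  refine mem_center_of_commute_generators (PresentedGroup.closure_range_of (relators v f)) ?_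
  rintro _ ⟨k, rfl⟩
  refine Commute.symm (commutatorElement_eq_one_iff_commute.1 ?_)
  exact PresentedGroup.one_of_mem (Or.inl (Or.inl ⟨i, j, k, rfl⟩))

theorem PGroup.commutator_pow (a b : PGroup v f) : ⁅a, b⁆ ^ p = 1 := by
  refine commutator_pow_eq_one_of_generators (PGroup.commutator_mem_center v f)
    (PresentedGroup.closure_range_of (relators v f)) ?_ a b
  rintro _ ⟨i, rfl⟩ _ ⟨j, rfl⟩
  exact PresentedGroup.one_of_mem (Or.inr ⟨i, j, rfl⟩)

theorem PGroup.pow_mem_center (a : PGroup v f) : a ^ p ∈ Subgroup.center (PGroup v f) := by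
  rw [Subgroup.mem_center_iff]
  intro b
  refine (commutatorElement_eq_one_iff_commute.1 ?_).symm
  rw [commutator_pow_left_of_central (PGroup.commutator_mem_center v f), PGroup.commutator_pow]

theorem PGroup.of_pow (i : Fin N) :
    (PresentedGroup.of i : PGroup v f) ^ powExp p
      = PresentedGroup.mk (relators v f) (commWord v (f (v i))) := by
  have h : PresentedGroup.mk (relators v f)
      (FreeGroup.of i ^ powExp p * (commWord v (f (v i)))⁻¹) = 1 :=
    PresentedGroup.one_of_mem (Or.inl (Or.inr ⟨i, rfl⟩))
  rw [map_mul, map_inv, mul_inv_eq_one, map_pow] at h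
  exact h

theorem PGroup.pow_powExp_mem_commutator (a : PGroup v f) :
    a ^ powExp p ∈ commutator (PGroup v f) := by
  let χ : PGroup v f →* Abelianization (PGroup v f) := Abelianization.of
  have hgen : Subgroup.closure (Set.range (PresentedGroup.of (rels := relators v f)))
      ≤ ((powMonoidHom (powExp p)).comp χ).ker := by
    rw [Subgroup.closure_le]
    rintro _ ⟨i, rfl⟩
    change χ _ ^ powExp p = 1
    rw [← map_pow, PGroup.of_pow]
    have h := map_commWord v (f (v i)) (χ.comp (PresentedGroup.mk (relators v f)))
      (1 : Multiplicative V →* Abelianization (PGroup v f)) 0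
      (fun j k => commutatorElement_eq_one_iff_commute.2 (Commute.all _ _))
    exact h
  rw [PresentedGroup.closure_range_of] at hgen
  have h1 : χ (a ^ powExp p) = 1 := by
    rw [map_pow]
    exact hgen (Subgroup.mem_top a)
  exact (QuotientGroup.eq_one_iff _).1 h1

theorem PGroup.pow_eq_one (a : PGroup v f) : a ^ (powExp p * p) = 1 := by
  rw [pow_mul]
  exact pow_eq_one_of_mem_commutator (PGroup.commutator_mem_center v f)
    (PGroup.commutator_pow v f) (PGroup.pow_powExp_mem_commutator v f a)

theorem PGroup.isPGroup : IsPGroup p (PGroup v f) := by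
  intro a
  have h := PGroup.pow_eq_one v f a
  unfold powExp at h
  split_ifs at h with hp
  · subst hp
    exact ⟨3, h⟩
  · exact ⟨2, by rw [pow_two]; exact h⟩

/-- The presented group maps to the group of `exists_model`, compatibly with the generators. -/
theorem PGroup.exists_hom_model :
    ∃ (E : Type u) (_ : Group E) (ε : E →* Multiplicative V)
      (ι : Multiplicative (⋀[ZMod p]^2 V) →* E) (ψ : PGroup v f →* E), Function.Injective ι ∧
      (∀ i, ε (ψ (PresentedGroup.of i)) = Multiplicative.ofAdd (v i)) ∧
      (∀ x y, ⁅x, y⁆ = ι (Multiplicative.ofAdd (wedge (ε x).toAdd (ε y).toAdd))) ∧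
      (∀ x, x ^ powExp p = ι (Multiplicative.ofAdd (f (ε x).toAdd))) := by
  obtain ⟨E, _, ε, ι, X, hι, hX, hcomm, hpow, hει⟩ := exists_model v f
  have hrel : ∀ r ∈ relators v f, FreeGroup.lift X r = 1 := by
    rintro r ((⟨i, j, k, rfl⟩ | ⟨i, rfl⟩) | ⟨i, j, rfl⟩)
    · rw [map_commutatorElement, map_commutatorElement, hcomm ⁅_, _⁆, hcomm, hει, toAdd_one,
        ← wedgeBilin_apply, map_zero, LinearMap.zero_apply, ofAdd_zero, map_one]
    · have h := map_commWord v (f (v i)) (FreeGroup.lift X) ι (fun j k => wedge (v j) (v k))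
        (fun j k => by simp only [FreeGroup.lift_apply_of, hcomm, hX, toAdd_ofAdd])
      rw [map_mul, map_inv, mul_inv_eq_one, map_pow, FreeGroup.lift_apply_of, hpow, hX, h]
      congr 2
      conv_lhs => rw [toAdd_ofAdd, ← sum_wedgeCoord v (f (v i))]
      simp only [← Nat.cast_smul_eq_nsmul (ZMod p), ZMod.natCast_zmod_val]
    · rw [map_pow, map_commutatorElement, hcomm, ← map_pow, ← ofAdd_nsmul,
        nsmul_eq_zero_of_dvd dvd_rfl, ofAdd_zero, map_one]
  refine ⟨E, _, ε, ι, PresentedGroup.toGroup hrel, hι, fun i => ?_, hcomm, hpow⟩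
  rw [PresentedGroup.toGroup.of, hX]

/-- The quotient of `P` by its centre is `V`, and the linear map induced on it by an endomorphism
of `P` intertwines `f` with its exterior square. -/
theorem PGroup.exists_hom_with_ker_eq_center (hN : 2 ≤ N) :
    ∃ π : PGroup v f →* Multiplicative V, Function.Surjective π ∧
      π.ker = Subgroup.center (PGroup v f) ∧
      (∀ i, π (PresentedGroup.of i) = Multiplicative.ofAdd (v i)) ∧
      ∀ (φ : PGroup v f →* PGroup v f) (g : V →ₗ[ZMod p] V),
        (∀ a, (π (φ a)).toAdd = g (π a).toAdd) → ∀ x, f (g x) = exteriorPower.map 2 g (f x) := by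
  obtain ⟨E, _, ε, ι, ψ, hι, hψ, hcomm, hpow⟩ := PGroup.exists_hom_model v f
  let π : PGroup v f →* Multiplicative V := ε.comp ψ
  have hπ : ∀ i, π (PresentedGroup.of i) = Multiplicative.ofAdd (v i) := hψ
  have hsurj : Function.Surjective π := by
    let T : AddSubgroup V := (MonoidHom.toAdditive π).range
    have hT : ∀ x, x ∈ T := by
      intro x
      rw [← v.sum_repr x]
      refine sum_mem fun i _ => ?_
      rw [← ZMod.natCast_zmod_val (v.repr x i), Nat.cast_smul_eq_nsmul]
      exact nsmul_mem (show v i ∈ T from ⟨Additive.ofMul (PresentedGroup.of i), hπ i⟩) _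
    intro x
    obtain ⟨a, ha⟩ := hT x.toAdd
    exact ⟨a.toMul, ha⟩
  -- `P / Z(P)` is an `𝔽_p`-space, so `v i ↦ x i` defines a map from `V` to it, inverse to `π`
  have hle : π.ker ≤ Subgroup.center (PGroup v f) := by
    let mk := QuotientGroup.mk' (Subgroup.center (PGroup v f))
    let _ : CommGroup (PGroup v f ⧸ Subgroup.center (PGroup v f)) :=
      { (inferInstance : Group (PGroup v f ⧸ Subgroup.center (PGroup v f))) with
        mul_comm := by
          intro a b
          obtain ⟨a, rfl⟩ := QuotientGroup.mk'_surjective _ a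
          obtain ⟨b, rfl⟩ := QuotientGroup.mk'_surjective _ b
          refine commutatorElement_eq_one_iff_commute.1 ?_
          rw [← map_commutatorElement]
          exact (QuotientGroup.eq_one_iff _).2 (PGroup.commutator_mem_center v f a b) }
    let _ : Module (ZMod p) (Additive (PGroup v f ⧸ Subgroup.center (PGroup v f))) :=
      AddCommGroup.zmodModule (by
        intro a
        obtain ⟨x, hx⟩ := QuotientGroup.mk'_surjective _ (Additive.toMul a)
        change Additive.toMul a ^ p = 1
        rw [← hx, ← map_pow]
        exact (QuotientGroup.eq_one_iff _).2 (PGroup.pow_mem_center v f x))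
    let s : V →ₗ[ZMod p] Additive (PGroup v f ⧸ Subgroup.center (PGroup v f)) :=
      v.constr (ZMod p) fun i => Additive.ofMul (mk (PresentedGroup.of i))
    have hs : (AddMonoidHom.toMultiplicativeLeft s.toAddMonoidHom).comp π = mk := by
      refine PresentedGroup.ext fun i => ?_
      rw [MonoidHom.comp_apply, hπ]
      exact congrArg Additive.toMul (v.constr_basis (ZMod p) _ i)
    intro a ha
    have h1 := DFunLike.congr_fun hs a
    rw [MonoidHom.comp_apply, MonoidHom.mem_ker.1 ha, map_one] at h1
    exact (QuotientGroup.eq_one_iff _).1 h1.symm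
  -- a central element has image `x` with `x ∧ V = 0`, because `W` embeds in `E`
  have hge : Subgroup.center (PGroup v f) ≤ π.ker := by
    intro z hz
    have hw : ∀ x : V, wedge (F := ZMod p) (π z).toAdd x = 0 := by
      intro x
      obtain ⟨y, hy⟩ := hsurj (Multiplicative.ofAdd x)
      have h1 : ⁅z, y⁆ = 1 :=
        commutatorElement_eq_one_iff_commute.2 (Subgroup.mem_center_iff.1 hz y).symm
      have h2 := congrArg ψ h1
      rw [map_commutatorElement, hcomm, map_one, ← map_one ι] at h2
      have h3 := hι h2
      rw [← toAdd_ofAdd x, ← hy]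
      exact h3
    have hz0 : (π z).toAdd = 0 := by
      refine v.ext_elem fun i => ?_
      obtain ⟨j, hj⟩ : ∃ j : Fin N, j ≠ i := by
        have : Nontrivial (Fin N) := Fin.nontrivial_iff_two_le.2 hN
        exact exists_ne i
      have h1 := congrArg (fun w => v.coord j (contraction (v.coord i) w)) (hw (v j))
      simpa [Finsupp.single_apply, hj] using h1
    exact hz0
  refine ⟨π, hsurj, le_antisymm hle hge, hπ, ?_⟩
  intro φ g hg
  suffices h : f ∘ₗ g = exteriorPower.map 2 g ∘ₗ f from fun x => LinearMap.congr_fun h x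
  refine v.ext fun i => ?_
  have h1 := congrArg (fun a => ψ (φ a)) (PGroup.of_pow v f i)
  have h2 := map_commWord v (f (v i)) ((ψ.comp φ).comp (PresentedGroup.mk (relators v f))) ι
    (fun j k => wedge (g (v j)) (g (v k))) (fun j k => by
      have hj := hg (PresentedGroup.of j)
      have hk := hg (PresentedGroup.of k)
      rw [hπ, toAdd_ofAdd] at hj hk
      rw [← hj, ← hk]
      exact hcomm _ _)
  have h3 := hg (PresentedGroup.of i)
  rw [hπ, toAdd_ofAdd] at h3
  simp only [map_pow, hpow] at h1
  have h4 := hι (h1.trans h2)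
  rw [LinearMap.comp_apply, LinearMap.comp_apply, ← h3]
  refine (Multiplicative.ofAdd.injective h4).trans ?_
  conv_rhs => rw [← sum_wedgeCoord v (f (v i))]
  simp only [map_sum]
  refine Finset.sum_congr rfl fun j _ => Finset.sum_congr rfl fun k _ => ?_
  split_ifs
  · rw [map_smul, map_wedge, ← Nat.cast_smul_eq_nsmul (ZMod p), ZMod.natCast_zmod_val]
  · rw [map_zero]

/-- The centre has finite index, so it is a finitely generated abelian torsion group. -/
theorem PGroup.finite {π : PGroup v f →* Multiplicative V}
    (hker : π.ker = Subgroup.center (PGroup v f)) : Finite (PGroup v f) := by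
  have : FiniteDimensional (ZMod p) V := v.finiteDimensional_of_finite
  have : Finite V := Module.finite_of_finite (ZMod p)
  have : Finite (Multiplicative V) := ‹Finite V›
  have hfi : (Subgroup.center (PGroup v f)).FiniteIndex := by
    rw [← hker]
    infer_instance
  have : Group.FG (PGroup v f) :=
    Group.fg_of_surjective (PresentedGroup.mk_surjective (relators v f))
  have htors : IsMulTorsion (Subgroup.center (PGroup v f)) := by
    intro z
    refine isOfFinOrder_iff_pow_eq_one.2 ⟨powExp p * p, ?_, Subtype.ext (PGroup.pow_eq_one v f z)⟩
    exact Nat.mul_pos (Nat.pos_of_ne_zero powExp_ne_zero) (Fact.out : p.Prime).pos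
  let _ : CommGroup (Subgroup.center (PGroup v f)) :=
    { (inferInstance : Group (Subgroup.center (PGroup v f))) with
      mul_comm := fun x y => Subtype.ext (Subgroup.mem_center_iff.1 y.2 x) }
  have : Finite (Subgroup.center (PGroup v f)) := CommGroup.finite_of_fg_isMulTorsion _ htors
  exact (finite_iff_subgroup_quotient (Subgroup.center (PGroup v f))).2
    ⟨this, inferInstance⟩

theorem PGroup.exists_induced_linearMap {π : PGroup v f →* Multiplicative V}
    (hπ : ∀ i, π (PresentedGroup.of i) = Multiplicative.ofAdd (v i))
    (φ : PGroup v f →* PGroup v f) :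
    ∃ g : V →ₗ[ZMod p] V, ∀ a, (π (φ a)).toAdd = g (π a).toAdd := by
  refine ⟨v.constr (ZMod p) fun i => (π (φ (PresentedGroup.of i))).toAdd, fun a => ?_⟩
  have h : π.comp φ = (AddMonoidHom.toMultiplicative (v.constr (ZMod p) fun i =>
      (π (φ (PresentedGroup.of i))).toAdd).toAddMonoidHom).comp π := by
    refine PresentedGroup.ext fun i => ?_
    rw [MonoidHom.comp_apply, MonoidHom.comp_apply, hπ]
    exact congrArg Multiplicative.ofAdd (v.constr_basis (ZMod p)
      (fun i => (π (φ (PresentedGroup.of i))).toAdd) i).symm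
  exact congrArg Multiplicative.toAdd (DFunLike.congr_fun h a)

end Presented

end CentralAuto

/-! ### Automorphisms of the presented group -/

open CentralAuto in
theorem mainTheorem2 (p : ℕ) [Fact p.Prime] (n : ℕ) (hn : 3 ≤ n)
    {V : Type*} [AddCommGroup V] [Module (ZMod p) V]
    (v : Module.Basis (Fin (n + 1)) (ZMod p) V)
    (α : (GaloisField p n)ˣ) (hα : ∀ x : (GaloisField p n)ˣ, x ∈ Subgroup.zpowers α)
    (b : Fin n → ZMod p) (hb : b ≠ 0)
    (c : {q : Fin n × Fin n // q.1 < q.2} → ZMod p) (hc : c ≠ 0)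
    (A : Matrix (Fin n) (Fin n) (ZMod p))
    (hA : A = CentralAuto.companion n (minpoly (ZMod p) (α : GaloisField p n)) ∨
      A = (CentralAuto.companion n (minpoly (ZMod p) (α : GaloisField p n))).transpose)
    (f : V →ₗ[ZMod p] ⋀[ZMod p]^2 V) (hf : CentralAuto.HasBlockMatrix v f b c A) :
    Finite (CentralAuto.PGroup v f) ∧
    IsPGroup p (CentralAuto.PGroup v f) ∧
    Group.IsNilpotent (CentralAuto.PGroup v f) ∧
    Group.nilpotencyClass (CentralAuto.PGroup v f) = 2 ∧
    CentralAuto.centralAut (CentralAuto.PGroup v f) = ⊤ ∧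
    (p ≠ 2 →
      (∃ a : CentralAuto.PGroup v f, a ∉ Subgroup.center (CentralAuto.PGroup v f)) ∧
      ∀ a : CentralAuto.PGroup v f, a ∉ Subgroup.center (CentralAuto.PGroup v f) →
        ∀ φ : MulAut (CentralAuto.PGroup v f), φ a ≠ a⁻¹) := by
  obtain ⟨π, hsurj, hker, hπ, hint⟩ := PGroup.exists_hom_with_ker_eq_center v f (by omega)
  have hmem : ∀ a, a ∈ Subgroup.center (PGroup v f) ↔ (π a).toAdd = 0 := by
    intro a
    rw [← hker]
    exact MonoidHom.mem_ker
  have hnc : (PresentedGroup.of 0 : PGroup v f) ∉ Subgroup.center (PGroup v f) := by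
    rw [hmem, hπ]
    exact v.ne_zero 0
  have hpres : ∀ (φ : MulAut (PGroup v f)) (a : PGroup v f), π (φ a) = π a := by
    intro φ a
    obtain ⟨g, hg⟩ := PGroup.exists_induced_linearMap v f hπ φ.toMonoidHom
    have hginj : Function.Injective g := by
      rw [injective_iff_map_eq_zero]
      intro x hx
      obtain ⟨y, hy⟩ := hsurj (Multiplicative.ofAdd x)
      have h1 : φ y ∈ Subgroup.center (PGroup v f) := by
        rw [hmem]
        refine (hg y).trans ?_
        rw [hy]
        exact hx
      have h2 : y ∈ Subgroup.center (PGroup v f) := by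
        rw [Subgroup.mem_center_iff] at h1 ⊢
        intro z
        apply φ.injective
        rw [map_mul, map_mul, h1]
      rw [hmem, hy] at h2
      exact h2
    have hgid := eq_id_of_intertwines hn v hα hb hc hA hf hginj (hint φ.toMonoidHom g hg)
    have h1 := hg a
    rw [hgid] at h1
    exact h1
  have hnil : Group.IsNilpotent (PGroup v f) := Subgroup.isNilpotent_of_ker_le_center π hker.le
  refine ⟨PGroup.finite v f hker, PGroup.isPGroup v f, hnil, le_antisymm ?_ ?_, ?_, ?_⟩
  · exact (Group.nilpotencyClass_le_of_ker_le_center π hker.le).trans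
      (Nat.succ_le_succ CommGroup.nilpotencyClass_le_one)
  · by_contra! h
    have h1 := Subgroup.upperCentralSeries_eq_top_iff_nilpotencyClass_le.2 (Nat.le_of_lt_succ h)
    rw [Subgroup.upperCentralSeries_one] at h1
    exact hnc (h1 ▸ Subgroup.mem_top _)
  · rw [eq_top_iff]
    intro φ _ a
    rw [hmem, map_mul, map_inv, hpres, inv_mul_cancel]
    rfl
  · intro hp2
    refine ⟨⟨_, hnc⟩, fun a ha φ hφ => ha ?_⟩
    have h1 := hpres φ a
    rw [hφ, map_inv] at h1
    rw [hmem]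
    have h2 : -(π a).toAdd = (π a).toAdd := congrArg Multiplicative.toAdd h1
    have h3 : (2 : ZMod p) • (π a).toAdd = 0 := by
      rw [two_smul]
      nth_rw 1 [← h2]
      exact neg_add_cancel _
    refine (smul_eq_zero.1 h3).resolve_left ?_
    have h4 : Fact (2 < p) := ⟨lt_of_le_of_ne (Fact.out : p.Prime).two_le (Ne.symm hp2)⟩
    exact Ring.two_ne_zero (by rwa [ZMod.ringChar_zmod_n])
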